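/- Let $\mathcal I=[0,1]$, let $\Theta(t-s)=1$ for $t\ge s$ and $0$ for $t<s$, and let $1_\star=\delta(t-s)$ be the Dirac delta. For distributions of the form $d(t,s)=\alpha\,\delta(t-s)+f(t,s)$ on $\mathcal I\times\mathcal I$, with $\alpha\in\mathbb C$ and $f$ a function, let $$(d\star e)(t,s)=\int_{\mathcal I} d(t,\tau)\,e(\tau,s)\,d\tau ,$$ so that $1_\star$ is the identity of $\star$. Let $\mathcal A_\Theta^t(\mathcal I)$ be the set of all $\tilde f(t)\Theta(t-s)$ with $\tilde f:\mathcal I\to\mathbb C$ analytic on $\mathcal I$, and let $\mathcal D_0^t(\mathcal I)$ be the set of all finite sums $\alpha 1_\star+\sum_{i=1}^n g_{i,1}\star\dots\star g_{i,m_i}$ with $\alpha\in\mathbb C$, $m_i\ge 1$ and $g_{i,j}\in\mathcal A_\Theta^t(\mathcal I)$. Let $p_k(t)=\sqrt{2k+1}\,P_k(2t-1)$, $k\ge 0$, be the orthonormal shifted Legendre polynomials on $\mathcal I$ ($P_k$ the Legendre polynomial). The coefficient matrix of $d$ is the infinite matrix with entries $$d_{k,\ell}=\int_{\mathcal I}\int_{\mathcal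 I} d(t,s)\,p_k(t)\,p_\ell(s)\,ds\,dt,\qquad k,\ell\ge 0;$$ in particular that of $1_\star$ is the identity matrix. Let $A=[A_{i,j}]_{i,j=1}^N$ be an $N\times N$ matrix with entries in $\mathcal D_0^t(\mathcal I)$, and let $A^{\star k}$ be its $k$-th power for the matrix $\star$-product. A series of such matrices is said to converge if, in every entry, the coefficients of $\delta(t-s)$ in the partial sums converge and the function parts of the partial sums converge uniformly on $\mathcal I\times\mathcal I$. 1. If no entry of $A$ has a delta component (all the coefficients of $\delta(t-s)$ are $0$), then $\sum_{k\ge1}A^{\star k}$ converges. 2. Whenever $C=\sum_{k\ge 1}A^{\star k}$ converges, let $\mathbf A=[F^{(i,j)}]_{i,j=1}^N$ and $\mathbf C=[H^{(i,j)}]_{i,j=1}^N$ be the infinite block matrices whose blocks are the coefficient matrices of the entries $A_{i,j}$ and $C_{i,j}$. Then $$(I+\mathbf C)(I-\mathbf A)=I\qquad\text{and}\qquad (I-\mathbf A)(I+\mathbf C)=I,$$ where all the series that define the entries of these two products converge absolutely. Thus $I-\mathbf A$ is invertible, with inverse $I+\mathbf C$. -/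

import Mathlib

open Filter Topology

/-- The distribution `δ(t-s)` with constant coefficient `delta`, plus the function `fn (t, s)`,
on the square `I × I`, where `I = [0,1]`:
`d(t,s) = delta • δ(t-s) + fn t s`.  The Heaviside factor `Θ(t-s)` is part of `fn`. -/
@[ext]
structure StarDist where
  delta : ℂ
  fn : unitInterval → unitInterval → ℂ

namespace StarDist

instance : Zero StarDist := ⟨⟨0, fun _ _ => 0⟩⟩

instance : Add StarDist := ⟨fun d e => ⟨d.delta + e.delta, fun t s => d.fn t s + e.fn t s⟩⟩

instance : SMul ℂ StarDist := ⟨fun c d => ⟨c * d.delta, fun t s => c * d.fn t s⟩⟩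

/-- The unit `1_⋆ = δ(t-s)`. -/
instance : One StarDist := ⟨⟨1, fun _ _ => 0⟩⟩

instance : AddCommMonoid StarDist where
  add_assoc a b c := StarDist.ext (add_assoc _ _ _)
    (funext fun _ => funext fun _ => add_assoc _ _ _)
  zero_add a := StarDist.ext (zero_add _) (funext fun _ => funext fun _ => zero_add _)
  add_zero a := StarDist.ext (add_zero _) (funext fun _ => funext fun _ => add_zero _)
  add_comm a b := StarDist.ext (add_comm _ _) (funext fun _ => funext fun _ => add_comm _ _)
  nsmul := nsmulRec

/-- The `⋆`-product `(d ⋆ e)(t,s) = ∫_I d(t,τ) e(τ,s) dτ`, with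
`∫_I δ(t-τ) e(τ,s) dτ = e(t,s)` and `∫_I d(t,τ) δ(τ-s) dτ = d(t,s)`.
It is written `*`; on matrices, `*` is then the matrix `⋆`-product. -/
noncomputable instance : Mul StarDist :=
  ⟨fun d e => ⟨d.delta * e.delta, fun t s =>
    d.delta * e.fn t s + d.fn t s * e.delta + ∫ τ : unitInterval, d.fn t τ * e.fn τ s⟩⟩

/-- The value of the distribution on a test function: `∫_I ∫_I d(t,s) φ(t,s) ds dt`. -/
noncomputable def pairing (d : StarDist) (φ : unitInterval → unitInterval → ℂ) : ℂ :=
  d.delta * (∫ t : unitInterval, φ t t) +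
    ∫ t : unitInterval, ∫ s : unitInterval, d.fn t s * φ t s

end StarDist

/-- The function `f(t) Θ(t-s)`, where `Θ(t-s) = 1` for `t ≥ s` and `0` for `t < s`. -/
noncomputable def heavisideMul (f : ℝ → ℂ) : StarDist :=
  open Classical in ⟨0, fun t s => if s ≤ t then f t else 0⟩

/-- `𝒜_Θ^t(I)`: the functions `f(t) Θ(t-s)` with `f` analytic on `I = [0,1]`. -/
def analyticTheta : Set StarDist :=
  {d | ∃ f : ℝ → ℂ, AnalyticOn ℝ f (Set.Icc 0 1) ∧ d = heavisideMul f}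

/-- `𝒟_0^t(I)`: the distributions `α 1_⋆ + ∑_i g_{i,1} ⋆ ⋯ ⋆ g_{i,m_i}` with `α ∈ ℂ`, and with
every `g_{i,j}` in `𝒜_Θ^t(I)`; the `i`-th factors are listed in `L i`. -/
def D0t : Set StarDist :=
  {d | ∃ (α : ℂ) (n : ℕ) (L : Fin n → List StarDist),
    (∀ i, L i ≠ [] ∧ ∀ g ∈ L i, g ∈ analyticTheta) ∧
    d = α • (1 : StarDist) + ∑ i, (L i).prod}

/-- The orthonormal shifted Legendre polynomial `p_k(t) = √(2k+1) P_k(2t-1)` on `[0,1]`.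
Mathlib's `shiftedLegendre k` is `P_k(1-2t)`, whence the sign. -/
noncomputable def legendreON (k : ℕ) (t : ℝ) : ℝ :=
  Real.sqrt (2 * k + 1) * ((-1) ^ k * Polynomial.aeval t (Polynomial.shiftedLegendre k))

/-- The coefficient matrix of `d`: `f_{k,l} = ∫_I ∫_I d(t,s) p_k(t) p_l(s) ds dt`. -/
noncomputable def coeffMatrix (d : StarDist) : Matrix ℕ ℕ ℂ :=
  Matrix.of fun k l => d.pairing fun t s => ((legendreON k t * legendreON l s : ℝ) : ℂ)

/-- The block matrix `[F^{(i,j)}]` of the coefficient matrices of the entries of `A`: the index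
`(i, k)` is the row `k` of the block row `i`. -/
noncomputable def blockCoeff {N : ℕ} (A : Matrix (Fin N) (Fin N) StarDist) :
    Matrix (Fin N × ℕ) (Fin N × ℕ) ℂ :=
  Matrix.of fun p q => coeffMatrix (A p.1 q.1) p.2 q.2

/-- `starPow A k` is the `⋆`-power `A^{⋆(k+1)}`. -/
noncomputable def starPow {N : ℕ} (A : Matrix (Fin N) (Fin N) StarDist) :
    ℕ → Matrix (Fin N) (Fin N) StarDist
  | 0 => A
  | k + 1 => starPow A k * A

/-- `C = ∑_{k ≥ 1} A^{⋆k}`: in every entry, the coefficients of `δ(t-s)` in the partial sums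
converge, and the function parts of the partial sums converge uniformly on `I × I`. -/
def IsStarSeriesSum {N : ℕ} (A C : Matrix (Fin N) (Fin N) StarDist) : Prop :=
  ∀ i j,
    Tendsto (fun n => (∑ k ∈ Finset.range n, starPow A k i j).delta) atTop (𝓝 (C i j).delta) ∧
    TendstoUniformly
      (fun n (x : unitInterval × unitInterval) =>
        (∑ k ∈ Finset.range n, starPow A k i j).fn x.1 x.2)
      (fun x => (C i j).fn x.1 x.2) atTop

/-- `X Y = Z` for infinite matrices: every entry of the product is an absolutely convergent
series, whose sum is the entry of `Z`. -/
def IsInfiniteProduct {ι : Type*} (X Y Z : Matrix ι ι ℂ) : Prop :=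
  ∀ p q, HasSum (fun r => X p r * Y r q) (Z p q)

/-! Taking coefficients turns `⋆` into the product of infinite matrices. The `(k,l)` coefficient of
`d ⋆ e` is `∫ u v`, where `u = p_k ⋆ d` and `v = e ⋆ p_l` are bounded functions of one variable.
Parseval's identity for the Legendre basis (`hasSum_integral_legendreON`) expands it into an
absolutely convergent series of products of coefficients of `d` and of `e`
(`hasSum_coeffMatrix_mul`). This requires the Legendre polynomials to be a Hilbert basis of
`L²([0,1])`, and `⋆` to be associative; the latter is Fubini's theorem for bounded measurable
kernels.

The partial sums `S_n` satisfy `S_n ⋆ A + A = S_{n+1} = A ⋆ S_n + A`. The limit gives `C ⋆ A + A = C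
= A ⋆ C + A`, and hence, on coefficients, `(I + C)(I - A) = I + C - A - CA = I`, and likewise in the
other order.

Convergence without delta parts is the Volterra estimate `norm_starPow_le`: causality restricts the
integrals to `τ ≥ s`, so each further factor integrates a power of `1 - τ` and produces a factorial.
-/

/-! ### Orthonormality of the shifted Legendre polynomials. -/

section Legendre

open Polynomial MeasureTheory

/-- Repeated integration by parts on `[0,1]`, with vanishing boundary terms. -/
theorem integral_mul_iterate_derivative (w : ℝ[X]) (n : ℕ)
    (hw : ∀ j < n, (derivative^[j] w).eval 0 = 0 ∧ (derivative^[j] w).eval 1 = 0) (p : ℝ[X]) :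
    ∫ t in (0 : ℝ)..1, p.eval t * (derivative^[n] w).eval t =
      (-1) ^ n * ∫ t in (0 : ℝ)..1, (derivative^[n] p).eval t * w.eval t := by
  induction n generalizing p with
  | zero => simp
  | succ n ih =>
    have h := intervalIntegral.integral_mul_deriv_eq_deriv_mul (a := 0) (b := 1)
      (u := fun t => p.eval t) (v := fun t => (derivative^[n] w).eval t)
      (fun x _ => p.hasDerivAt x) (fun x _ => (derivative^[n] w).hasDerivAt x)
      (p.derivative.continuous.intervalIntegrable 0 1)
      ((derivative (derivative^[n] w)).continuous.intervalIntegrable 0 1)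
    rw [Function.iterate_succ_apply', h, (hw n n.lt_succ_self).1, (hw n n.lt_succ_self).2,
      ih (fun j hj => hw j (hj.trans n.lt_succ_self)), Function.iterate_succ_apply]
    ring

/-- The beta integral with integer exponents. -/
theorem integral_pow_mul_one_sub_pow (n m : ℕ) :
    ((n + m + 1).factorial : ℝ) * ∫ t in (0 : ℝ)..1, t ^ n * (1 - t) ^ m =
      n.factorial * m.factorial := by
  induction n generalizing m with
  | zero =>
    have h : ∫ t in (0 : ℝ)..1, (1 - t) ^ m = 1 / (m + 1) := by
      rw [intervalIntegral.integral_comp_sub_left (fun t : ℝ => t ^ m) 1]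
      simp
    simp only [pow_zero, one_mul, zero_add, h, Nat.factorial_succ]
    push_cast
    field_simp
    simp
  | succ n ih =>
    have h := intervalIntegral.integral_mul_deriv_eq_deriv_mul (a := 0) (b := 1)
      (u := fun t : ℝ => t ^ (n + 1)) (v := fun t : ℝ => -(1 - t) ^ (m + 1) / (m + 1))
      (u' := fun t => ((n + 1 : ℕ) : ℝ) * t ^ n) (v' := fun t => (1 - t) ^ m)
      (fun x _ => by simpa using hasDerivAt_pow (n + 1) x)
      (fun x _ => by
        have := ((((hasDerivAt_id x).const_sub 1).pow (m + 1)).neg).div_const ((m : ℝ) + 1)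
        convert! this using 1
        have : (m : ℝ) + 1 ≠ 0 := by positivity
        simp
        field_simp)
      (Continuous.intervalIntegrable (by fun_prop) 0 1)
      (Continuous.intervalIntegrable (by fun_prop) 0 1)
    have e : ∫ t in (0 : ℝ)..1, ((n + 1 : ℕ) : ℝ) * t ^ n * (-(1 - t) ^ (m + 1) / (m + 1)) =
        -((n + 1) / (m + 1)) * ∫ t in (0 : ℝ)..1, t ^ n * (1 - t) ^ (m + 1) := by
      rw [← intervalIntegral.integral_const_mul]
      congr 1
      ext t
      push_cast
      ring
    have ih' := ih (m + 1)
    rw [h, e, show n + 1 + m + 1 = n + (m + 1) + 1 by ring]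
    have hm : (m : ℝ) + 1 ≠ 0 := by positivity
    rw [Nat.factorial_succ m] at ih'
    rw [Nat.factorial_succ n]
    push_cast at ih' ⊢
    simp
    field_simp
    linear_combination ih'

/-- The shifted Legendre polynomial with real coefficients. -/
noncomputable def realShiftedLegendre (n : ℕ) : ℝ[X] :=
  (shiftedLegendre n).map (Int.castRingHom ℝ)

/-- Rodrigues' formula, the form in which integration by parts applies. -/
theorem factorial_mul_realShiftedLegendre (n : ℕ) :
    (n.factorial : ℝ[X]) * realShiftedLegendre n =
      derivative^[n] (X ^ n * (1 - (X : ℝ[X])) ^ n) := by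
  have h := congrArg (Polynomial.map (Int.castRingHom ℝ)) (factorial_mul_shiftedLegendre_eq n)
  rw [← iterate_derivative_map] at h
  simpa [realShiftedLegendre] using h

theorem degree_realShiftedLegendre (n : ℕ) : (realShiftedLegendre n).degree = n := by
  rw [realShiftedLegendre, degree_map_eq_of_injective (RingHom.injective_int _),
    degree_shiftedLegendre]

theorem natDegree_realShiftedLegendre (n : ℕ) : (realShiftedLegendre n).natDegree = n :=
  natDegree_eq_of_degree_eq_some (degree_realShiftedLegendre n)

/-- Rodrigues' formula moves `n` derivatives onto `p`. Orthogonality follows from `deg p < n`, the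
norm from taking `p` to be the Legendre polynomial itself. -/
theorem factorial_mul_integral_mul_realShiftedLegendre (n : ℕ) (p : ℝ[X]) :
    n.factorial * ∫ t in (0 : ℝ)..1, p.eval t * (realShiftedLegendre n).eval t =
      (-1) ^ n * ∫ t in (0 : ℝ)..1, (derivative^[n] p).eval t * (t ^ n * (1 - t) ^ n) := by
  have hw : ∀ j < n, (derivative^[j] (X ^ n * (1 - (X : ℝ[X])) ^ n)).eval 0 = 0 ∧
      (derivative^[j] (X ^ n * (1 - (X : ℝ[X])) ^ n)).eval 1 = 0 := by
    intro j hj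
    -- After `j < n` derivatives a positive power of `X` and of `1 - X` still divides the
    -- polynomial, so the boundary terms vanish.
    have hj' : n - j ≠ 0 := by omega
    constructor
    · obtain ⟨q, hq⟩ := pow_sub_dvd_iterate_derivative_of_pow_dvd j
        (dvd_mul_right ((X : ℝ[X]) ^ n) ((1 - (X : ℝ[X])) ^ n))
      simp [hq, hj']
    · obtain ⟨q, hq⟩ := pow_sub_dvd_iterate_derivative_of_pow_dvd j
        (dvd_mul_left ((1 - (X : ℝ[X])) ^ n) ((X : ℝ[X]) ^ n))
      simp [hq, hj']
  have h := integral_mul_iterate_derivative _ n hw p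
  rw [← factorial_mul_realShiftedLegendre] at h
  rw [← intervalIntegral.integral_const_mul]
  simpa [mul_left_comm] using h

theorem integral_realShiftedLegendre_of_lt {m n : ℕ} (h : m < n) :
    ∫ t in (0 : ℝ)..1, (realShiftedLegendre m).eval t * (realShiftedLegendre n).eval t = 0 := by
  have := factorial_mul_integral_mul_realShiftedLegendre n (realShiftedLegendre m)
  rw [iterate_derivative_eq_zero (by rwa [natDegree_realShiftedLegendre])] at this
  simpa [n.factorial_ne_zero] using this

/-- Only the leading coefficient `(-1)^n * (2n choose n)` survives, multiplied by `n!`. -/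
theorem iterate_derivative_realShiftedLegendre (n : ℕ) :
    derivative^[n] (realShiftedLegendre n) = C ((-1) ^ n * ((2 * n).factorial / n.factorial : ℝ)) := by
  ext k
  rw [coeff_iterate_derivative, realShiftedLegendre, coeff_map, coeff_shiftedLegendre, coeff_C]
  rcases Nat.eq_zero_or_pos k with rfl | hk
  · have h1 := Nat.add_choose_mul_factorial_mul_factorial n n
    have h2 : ((n + n).choose n : ℝ) * n.factorial * n.factorial = (2 * n).factorial := by
      rw [two_mul]
      exact_mod_cast h1
    have h3 : (n.factorial : ℝ) ≠ 0 := by exact_mod_cast n.factorial_ne_zero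
    simp [Nat.descFactorial_self]
    field_simp
    linear_combination h2
  · simp [Nat.choose_eq_zero_of_lt (show n < k + n by omega), hk.ne']

/-- The constant `n`-th derivative leaves the beta integral `(n!)² / (2n+1)!`; the two signs
`(-1)^n` cancel. -/
theorem integral_realShiftedLegendre_self (n : ℕ) :
    (2 * n + 1) * ∫ t in (0 : ℝ)..1,
      (realShiftedLegendre n).eval t * (realShiftedLegendre n).eval t = 1 := by
  have h := factorial_mul_integral_mul_realShiftedLegendre n (realShiftedLegendre n)
  have hb := integral_pow_mul_one_sub_pow n n
  have h3 : (n.factorial : ℝ) ≠ 0 := by exact_mod_cast n.factorial_ne_zero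
  have h4 : ((2 * n).factorial : ℝ) ≠ 0 := by exact_mod_cast (2 * n).factorial_ne_zero
  rw [iterate_derivative_realShiftedLegendre] at h
  simp only [eval_C] at h
  rw [intervalIntegral.integral_const_mul] at h
  rw [← two_mul, Nat.factorial_succ] at hb
  push_cast at hb
  have hs : ((-1 : ℝ) ^ n) * (-1) ^ n = 1 := by rw [← mul_pow]; simp
  generalize (∫ t in (0 : ℝ)..1, t ^ n * (1 - t) ^ n) = b at *
  generalize (∫ t in (0 : ℝ)..1, (realShiftedLegendre n).eval t * (realShiftedLegendre n).eval t)
    = x at *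
  rw [← mul_assoc, ← mul_assoc, hs, one_mul] at h
  field_simp at h
  have : (n.factorial : ℝ) ^ 2 * ((2 * n + 1) * x) = n.factorial ^ 2 * 1 := by
    linear_combination (2 * (n : ℝ) + 1) * h + hb
  exact mul_left_cancel₀ (pow_ne_zero 2 h3) this

theorem legendreON_eq (k : ℕ) (t : ℝ) :
    legendreON k t = (√(2 * k + 1) * (-1) ^ k) * (realShiftedLegendre k).eval t := by
  rw [legendreON, realShiftedLegendre, ← eval_map_algebraMap, algebraMap_int_eq, mul_assoc]

theorem integral_legendreON (k l : ℕ) :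
    ∫ t in (0 : ℝ)..1, legendreON k t * legendreON l t = if k = l then 1 else 0 := by
  have e : ∀ t, legendreON k t * legendreON l t =
      ((√(2 * k + 1) * (-1) ^ k) * (√(2 * l + 1) * (-1) ^ l)) *
        ((realShiftedLegendre k).eval t * (realShiftedLegendre l).eval t) := by
    intro t
    rw [legendreON_eq, legendreON_eq]
    ring
  simp_rw [e]
  rw [intervalIntegral.integral_const_mul]
  split_ifs with h
  · subst h
    have hs : ((-1 : ℝ) ^ k) * (-1) ^ k = 1 := by rw [← mul_pow]; simp
    have hq := Real.mul_self_sqrt (show (0 : ℝ) ≤ 2 * k + 1 by positivity)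
    have hi := integral_realShiftedLegendre_self k
    generalize (∫ t in (0 : ℝ)..1,
      (realShiftedLegendre k).eval t * (realShiftedLegendre k).eval t) = x at *
    linear_combination √(2 * k + 1) * √(2 * k + 1) * x * hs + x * hq + hi
  · rcases lt_or_gt_of_ne h with h | h
    · rw [integral_realShiftedLegendre_of_lt h, mul_zero]
    · simp_rw [mul_comm ((realShiftedLegendre k).eval _)]
      rw [integral_realShiftedLegendre_of_lt h, mul_zero]

theorem continuous_legendreON (k : ℕ) : Continuous (legendreON k) := by
  simp_rw [funext (legendreON_eq k)]
  fun_prop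

/-! ### Completeness in `L²([0,1])` and Parseval's identity. -/

theorem integral_unitInterval_eq (f : ℝ → ℝ) :
    ∫ t : unitInterval, f t = ∫ t in (0 : ℝ)..1, f t := by
  rw [intervalIntegral.integral_of_le zero_le_one, ← integral_Icc_eq_integral_Ioc]
  exact integral_subtype measurableSet_Icc f

/-- The orthonormal Legendre polynomial as a complex valued continuous function on `[0,1]`. -/
noncomputable def legendreC (k : ℕ) : C(unitInterval, ℂ) :=
  ⟨fun t => (legendreON k t : ℂ), by
    have := continuous_legendreON k
    fun_prop⟩

/-- The orthonormal Legendre polynomials, as polynomials. -/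
noncomputable def legendreSequence : Polynomial.Sequence ℝ where
  elems' k := C (√(2 * k + 1) * (-1) ^ k) * realShiftedLegendre k
  degree_eq' k := by
    rw [degree_C_mul, degree_realShiftedLegendre]
    exact mul_ne_zero (Real.sqrt_ne_zero'.2 (by positivity)) (pow_ne_zero _ (by norm_num))

/-- A sequence with one polynomial in each degree spans all real polynomials; the real coefficients
are then read as complex ones. -/
theorem ofReal_comp_mem_span_legendreC (p : ℝ[X]) (f : C(unitInterval, ℂ))
    (hf : ∀ t, f t = ((p.eval (t : ℝ) : ℝ) : ℂ)) :
    f ∈ Submodule.span ℂ (Set.range legendreC) := by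
  have hp : p ∈ Submodule.span ℝ (Set.range legendreSequence) := by
    rw [legendreSequence.span
      fun i => isUnit_iff_ne_zero.2 (leadingCoeff_ne_zero.2 (legendreSequence.ne_zero i))]
    trivial
  induction hp using Submodule.span_induction generalizing f with
  | mem x hx =>
    obtain ⟨k, rfl⟩ := hx
    refine Submodule.subset_span ⟨k, ?_⟩
    ext t
    rw [hf]
    simp [legendreC, legendreON_eq, legendreSequence]
  | zero =>
    have : f = 0 := by ext t; simp [hf]
    simp [this]
  | add x y _ _ hx hy =>
    have e : f = ⟨fun t => ((x.eval (t : ℝ) : ℝ) : ℂ), by fun_prop⟩ +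
        ⟨fun t => ((y.eval (t : ℝ) : ℝ) : ℂ), by fun_prop⟩ := by
      ext t; simp [hf]
    rw [e]
    exact add_mem (hx _ fun _ => rfl) (hy _ fun _ => rfl)
  | smul a x _ hx =>
    have e : f = (a : ℂ) • ⟨fun t => ((x.eval (t : ℝ) : ℝ) : ℂ), by fun_prop⟩ := by
      ext t; simp [hf]
    rw [e]
    exact Submodule.smul_mem _ _ (hx _ fun _ => rfl)

/-- Weierstrass approximation handles real functions; a complex function is split into real and
imaginary parts. -/
theorem span_legendreC_closure_eq_top :
    (Submodule.span ℂ (Set.range legendreC)).topologicalClosure = ⊤ := by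
  set S := (Submodule.span ℂ (Set.range legendreC)).topologicalClosure
  let T : C(unitInterval, ℝ) → C(unitInterval, ℂ) :=
    fun g => (⟨fun x : ℝ => (x : ℂ), by fun_prop⟩ : C(ℝ, ℂ)).comp g
  have hT : Continuous T := ContinuousMap.continuous_postcomp _
  have hreal : ∀ g : C(unitInterval, ℝ), T g ∈ S := by
    intro g
    have hcl : IsClosed {g | T g ∈ S} :=
      (Submodule.isClosed_topologicalClosure _).preimage hT
    have hg : g ∈ (polynomialFunctions unitInterval).topologicalClosure := by
      rw [polynomialFunctions_closure_eq_top']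
      trivial
    refine closure_minimal ?_ hcl hg
    rintro _ ⟨p, -, rfl⟩
    refine Submodule.le_topologicalClosure _ (ofReal_comp_mem_span_legendreC p _ fun t => ?_)
    simp [T]
  rw [eq_top_iff]
  intro f _
  have e : f = T ⟨fun t => (f t).re, by fun_prop⟩ +
      Complex.I • T ⟨fun t => (f t).im, by fun_prop⟩ := by
    ext t
    simp only [T, ContinuousMap.add_apply, ContinuousMap.comp_apply, ContinuousMap.coe_mk,
      ContinuousMap.smul_apply, smul_eq_mul]
    rw [mul_comm, Complex.re_add_im]
  rw [e]
  exact add_mem (hreal _) (Submodule.smul_mem _ _ (hreal _))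

/-- The orthonormal Legendre polynomials in `L²([0,1])`. -/
noncomputable def legendreL2 (k : ℕ) : Lp ℂ 2 (volume : Measure unitInterval) :=
  ContinuousMap.toLp 2 volume ℂ (legendreC k)

theorem integral_legendreON_mul_ofReal (k l : ℕ) :
    ∫ t : unitInterval, ((legendreON k t * legendreON l t : ℝ) : ℂ) = if k = l then 1 else 0 := by
  rw [integral_complex_ofReal, integral_unitInterval_eq fun t => legendreON k t * legendreON l t,
    integral_legendreON]
  split_ifs <;> simp

theorem orthonormal_legendreL2 : Orthonormal ℂ legendreL2 := by
  rw [orthonormal_iff_ite]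
  intro k l
  rw [legendreL2, legendreL2, ContinuousMap.inner_toLp, ← integral_legendreON_mul_ofReal]
  congr 1
  ext t
  simp [legendreC, mul_comm]

/-- Continuous functions are dense in `L²`, so a uniformly dense span has dense image. -/
theorem span_legendreL2_closure_eq_top :
    (Submodule.span ℂ (Set.range legendreL2)).topologicalClosure = ⊤ := by
  have h := (ContinuousMap.toLp_denseRange ℂ (volume : Measure unitInterval) ℂ
    (p := 2) (by simp)).topologicalClosure_map_submodule span_legendreC_closure_eq_top
  rw [Submodule.map_span, ← Set.range_comp] at h
  exact h

/-- The Legendre polynomials as a Hilbert basis of `L²([0,1])`. -/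
noncomputable def legendreBasis : HilbertBasis ℕ ℂ (Lp ℂ 2 (volume : Measure unitInterval)) :=
  HilbertBasis.mk orthonormal_legendreL2 span_legendreL2_closure_eq_top.ge

/-- Parseval's identity for the Legendre polynomials, in bilinear form. -/
theorem hasSum_integral_legendreON {u v : unitInterval → ℂ} (hu : MemLp u 2 volume)
    (hv : MemLp v 2 volume) :
    HasSum (fun r => (∫ t : unitInterval, u t * legendreON r t) *
      ∫ t : unitInterval, legendreON r t * v t) (∫ t, u t * v t) := by
  -- The inner product is conjugate linear in its first argument; conjugating `u` beforehand makes
  -- the identity bilinear.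
  have hu' : MemLp (fun t => star (u t)) 2 volume := hu.star
  have h := legendreBasis.hasSum_inner_mul_inner (hu'.toLp _) (hv.toLp _)
  have hb : ∀ r, legendreBasis r = legendreL2 r := fun r => by
    rw [legendreBasis, HilbertBasis.coe_mk]
  simp only [hb, L2.inner_def] at h
  convert! h using 1
  · ext r
    congr 1
    · refine integral_congr_ae ?_
      filter_upwards [hu'.coeFn_toLp, ContinuousMap.coeFn_toLp (𝕜 := ℂ) (p := 2) volume (legendreC r)]
        with t h1 h2
      rw [h1, legendreL2, h2]
      simp [legendreC, mul_comm]
    · refine integral_congr_ae ?_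
      filter_upwards [hv.coeFn_toLp, ContinuousMap.coeFn_toLp (𝕜 := ℂ) (p := 2) volume (legendreC r)]
        with t h1 h2
      rw [h1, legendreL2, h2]
      simp [legendreC, mul_comm]
  · refine integral_congr_ae ?_
    filter_upwards [hu'.coeFn_toLp, hv.coeFn_toLp] with t h1 h2
    rw [h1, h2]
    simp [mul_comm]

end Legendre

/-! ### The `⋆`-semiring of bounded measurable kernels. -/

namespace StarDist

open MeasureTheory

@[simp] theorem zero_delta : (0 : StarDist).delta = 0 := rfl
@[simp] theorem zero_fn (t s : unitInterval) : (0 : StarDist).fn t s = 0 := rfl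
@[simp] theorem one_delta : (1 : StarDist).delta = 1 := rfl
@[simp] theorem one_fn (t s : unitInterval) : (1 : StarDist).fn t s = 0 := rfl
@[simp] theorem add_delta (d e : StarDist) : (d + e).delta = d.delta + e.delta := rfl
@[simp] theorem add_fn (d e : StarDist) (t s : unitInterval) :
    (d + e).fn t s = d.fn t s + e.fn t s := rfl
@[simp] theorem smul_fn (c : ℂ) (d : StarDist) (t s : unitInterval) :
    (c • d).fn t s = c * d.fn t s := rfl
@[simp] theorem mul_delta (d e : StarDist) : (d * e).delta = d.delta * e.delta := rfl
@[simp] theorem mul_fn (d e : StarDist) (t s : unitInterval) : (d * e).fn t s =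
    d.delta * e.fn t s + d.fn t s * e.delta + ∫ τ : unitInterval, d.fn t τ * e.fn τ s := rfl

theorem sum_delta {ι : Type*} (S : Finset ι) (d : ι → StarDist) :
    (∑ i ∈ S, d i).delta = ∑ i ∈ S, (d i).delta :=
  map_sum (⟨⟨StarDist.delta, rfl⟩, fun _ _ => rfl⟩ : StarDist →+ ℂ) d S

theorem sum_fn {ι : Type*} (S : Finset ι) (d : ι → StarDist) (t s : unitInterval) :
    (∑ i ∈ S, d i).fn t s = ∑ i ∈ S, (d i).fn t s :=
  map_sum (⟨⟨fun d => d.fn t s, rfl⟩, fun _ _ => rfl⟩ : StarDist →+ ℂ) d S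

/-- The distributions whose function part is measurable and bounded. -/
def boundedMeasurable : AddSubmonoid StarDist where
  carrier := {d | Measurable (Function.uncurry d.fn) ∧ ∃ M, ∀ t s, ‖d.fn t s‖ ≤ M}
  zero_mem' := ⟨measurable_const, 0, fun _ _ => by simp⟩
  add_mem' := by
    rintro d e ⟨hd, M, hM⟩ ⟨he, K, hK⟩
    exact ⟨hd.add he, M + K, fun t s => norm_add_le_of_le (hM t s) (hK t s)⟩

theorem one_mem_boundedMeasurable : (1 : StarDist) ∈ boundedMeasurable :=
  ⟨measurable_const, 0, fun _ _ => by simp⟩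

theorem smul_mem_boundedMeasurable (c : ℂ) {d : StarDist} (hd : d ∈ boundedMeasurable) :
    c • d ∈ boundedMeasurable := by
  obtain ⟨hd, M, hM⟩ := hd
  refine ⟨hd.const_mul c, ‖c‖ * M, fun t s => ?_⟩
  rw [smul_fn, norm_mul]
  exact mul_le_mul_of_nonneg_left (hM t s) (norm_nonneg c)

variable {a b c d e : StarDist}

theorem measurable_left (hd : d ∈ boundedMeasurable) (s : unitInterval) :
    Measurable fun t => d.fn t s :=
  hd.1.comp (measurable_id.prodMk measurable_const)

theorem measurable_right (hd : d ∈ boundedMeasurable) (t : unitInterval) :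
    Measurable fun s => d.fn t s :=
  hd.1.comp (measurable_const.prodMk measurable_id)

theorem exists_pos_bound (hd : d ∈ boundedMeasurable) : ∃ M, 0 < M ∧ ∀ t s, ‖d.fn t s‖ ≤ M := by
  obtain ⟨-, M, hM⟩ := hd
  exact ⟨max M 1, by positivity, fun t s => (hM t s).trans (le_max_left _ _)⟩

theorem integrable_mul (hd : d ∈ boundedMeasurable) (he : e ∈ boundedMeasurable)
    (t s : unitInterval) : Integrable fun τ => d.fn t τ * e.fn τ s := by
  obtain ⟨M, hM0, hM⟩ := exists_pos_bound hd
  obtain ⟨K, hK0, hK⟩ := exists_pos_bound he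
  refine Integrable.of_bound
    ((measurable_right hd t).mul (measurable_left he s)).aestronglyMeasurable (M * K)
    (ae_of_all _ fun τ => ?_)
  rw [norm_mul]
  exact mul_le_mul (hM _ _) (hK _ _) (norm_nonneg _) hM0.le

theorem mul_mem_boundedMeasurable (hd : d ∈ boundedMeasurable) (he : e ∈ boundedMeasurable) :
    d * e ∈ boundedMeasurable := by
  obtain ⟨M, hM0, hM⟩ := exists_pos_bound hd
  obtain ⟨K, hK0, hK⟩ := exists_pos_bound he
  constructor
  · refine ((he.1.const_mul _).add (hd.1.mul_const _)).add ?_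
    have h : Measurable fun p : (unitInterval × unitInterval) × unitInterval =>
        d.fn p.1.1 p.2 * e.fn p.2 p.1.2 :=
      (hd.1.comp (measurable_fst.fst.prodMk measurable_snd)).mul
        (he.1.comp (measurable_snd.prodMk measurable_fst.snd))
    exact h.stronglyMeasurable.integral_prod_right'.measurable
  · refine ⟨‖d.delta‖ * K + M * ‖e.delta‖ + M * K, fun t s => ?_⟩
    refine norm_add_le_of_le (norm_add_le_of_le ?_ ?_) ?_
    · rw [norm_mul]
      exact mul_le_mul_of_nonneg_left (hK _ _) (norm_nonneg _)
    · rw [norm_mul]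
      exact mul_le_mul_of_nonneg_right (hM _ _) (norm_nonneg _)
    · have := norm_integral_le_of_norm_le_const (μ := (volume : Measure unitInterval))
        (f := fun τ => d.fn t τ * e.fn τ s) (C := M * K) (ae_of_all _ fun τ => by
          rw [norm_mul]
          exact mul_le_mul (hM _ _) (hK _ _) (norm_nonneg _) hM0.le)
      simpa using this

theorem star_mul_add (ha : a ∈ boundedMeasurable) (hb : b ∈ boundedMeasurable)
    (hc : c ∈ boundedMeasurable) : a * (b + c) = a * b + a * c := by
  ext t s
  · simp [mul_add]
  · simp only [mul_fn, add_fn, add_delta, mul_add]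
    rw [integral_add (integrable_mul ha hb t s) (integrable_mul ha hc t s)]
    ring

theorem star_add_mul (ha : a ∈ boundedMeasurable) (hb : b ∈ boundedMeasurable)
    (hc : c ∈ boundedMeasurable) : (a + b) * c = a * c + b * c := by
  ext t s
  · simp [add_mul]
  · simp only [mul_fn, add_fn, add_delta, add_mul]
    rw [integral_add (integrable_mul ha hc t s) (integrable_mul hb hc t s)]
    ring

theorem integral_mul_integral_swap (ha : a ∈ boundedMeasurable) (hb : b ∈ boundedMeasurable)
    (hc : c ∈ boundedMeasurable) (t s : unitInterval) :
    ∫ σ : unitInterval, (∫ τ : unitInterval, a.fn t τ * b.fn τ σ) * c.fn σ s =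
      ∫ τ : unitInterval, a.fn t τ * ∫ σ : unitInterval, b.fn τ σ * c.fn σ s := by
  obtain ⟨M, hM0, hM⟩ := exists_pos_bound ha
  obtain ⟨K, hK0, hK⟩ := exists_pos_bound hb
  obtain ⟨L, hL0, hL⟩ := exists_pos_bound hc
  simp_rw [← integral_mul_const, ← integral_const_mul]
  rw [integral_integral_swap]
  · simp_rw [mul_assoc]
  · refine Integrable.of_bound (C := M * K * L) (Measurable.aestronglyMeasurable ?_)
      (ae_of_all _ fun p => ?_)
    · exact (((measurable_right ha t).comp measurable_snd).mul
        (hb.1.comp measurable_swap)).mul ((measurable_left hc s).comp measurable_fst)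
    · simp only [Function.uncurry, norm_mul]
      have := hM t p.2
      have := hK p.2 p.1
      have := hL p.1 s
      gcongr

theorem integral_combination {f g h : unitInterval → ℂ} {α β : ℂ} (hf : Integrable f)
    (hg : Integrable g) (hfgh : Integrable fun τ => α * f τ + β * g τ + h τ) :
    ∫ τ, α * f τ + β * g τ + h τ = α * (∫ τ, f τ) + β * (∫ τ, g τ) + ∫ τ, h τ := by
  have hfg : Integrable fun τ => α * f τ + β * g τ := (hf.const_mul α).add (hg.const_mul β)
  have hh : Integrable h := (integrable_add_iff_integrable_right hfg).1 hfgh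
  rw [integral_add hfg hh, integral_add (hf.const_mul α) (hg.const_mul β), integral_const_mul,
    integral_const_mul]

/-- The terms containing a delta factor match algebraically; the triple product of function parts is
Fubini's theorem, `integral_mul_integral_swap`. -/
theorem star_mul_assoc (ha : a ∈ boundedMeasurable) (hb : b ∈ boundedMeasurable)
    (hc : c ∈ boundedMeasurable) : a * b * c = a * (b * c) := by
  ext t s
  · simp [mul_assoc]
  · have hl : (fun σ => (a * b).fn t σ * c.fn σ s) = fun σ =>
        a.delta * (b.fn t σ * c.fn σ s) + b.delta * (a.fn t σ * c.fn σ s) +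
          (∫ τ : unitInterval, a.fn t τ * b.fn τ σ) * c.fn σ s := by
      ext σ
      rw [mul_fn]
      ring
    have hr : (fun τ => a.fn t τ * (b * c).fn τ s) = fun τ =>
        b.delta * (a.fn t τ * c.fn τ s) + c.delta * (a.fn t τ * b.fn τ s) +
          a.fn t τ * ∫ σ : unitInterval, b.fn τ σ * c.fn σ s := by
      ext τ
      rw [mul_fn]
      ring
    have ac := integrable_mul ha hc t s
    have ab := integrable_mul ha hb t s
    have bc := integrable_mul hb hc t s
    have il := integrable_mul (mul_mem_boundedMeasurable ha hb) hc t s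
    have ir := integrable_mul ha (mul_mem_boundedMeasurable hb hc) t s
    rw [hl] at il
    rw [hr] at ir
    rw [mul_fn (a * b) c, mul_fn a (b * c), hl, hr, integral_combination bc ac il,
      integral_combination ac ab ir, integral_mul_integral_swap ha hb hc]
    simp only [mul_fn, mul_delta]
    ring

/-- The distributions with bounded measurable function part form a semiring under `⋆`. -/
noncomputable instance : Semiring boundedMeasurable where
  mul x y := ⟨x * y, mul_mem_boundedMeasurable x.2 y.2⟩
  one := ⟨1, one_mem_boundedMeasurable⟩
  left_distrib x y z := Subtype.ext (star_mul_add x.2 y.2 z.2)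
  right_distrib x y z := Subtype.ext (star_add_mul x.2 y.2 z.2)
  mul_assoc x y z := Subtype.ext (star_mul_assoc x.2 y.2 z.2)
  zero_mul x := Subtype.ext (StarDist.ext (zero_mul x.1.delta) (by
    ext t s
    change (0 * x : StarDist).fn t s = 0
    simp))
  mul_zero x := Subtype.ext (StarDist.ext (mul_zero x.1.delta) (by
    ext t s
    change (x * 0 : StarDist).fn t s = 0
    simp))
  one_mul x := Subtype.ext (StarDist.ext (one_mul x.1.delta) (by
    ext t s
    change (1 * x : StarDist).fn t s = x.1.fn t s
    simp))
  mul_one x := Subtype.ext (StarDist.ext (mul_one x.1.delta) (by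
    ext t s
    change (x * 1 : StarDist).fn t s = x.1.fn t s
    simp))

theorem coe_mul (x y : boundedMeasurable) : ((x * y : boundedMeasurable) : StarDist) = x * y := rfl

/-! ### Causality, and membership of `D0t` in the semiring. -/

/-- The function part vanishes for `t < s`. -/
def IsCausal (d : StarDist) : Prop := ∀ t s, t < s → d.fn t s = 0

/-- If `t < s`, no `τ` satisfies `s ≤ τ ≤ t`, so the integrand vanishes everywhere. -/
theorem IsCausal.mul (hd : d.IsCausal) (he : e.IsCausal) : (d * e).IsCausal := by
  intro t s h
  rw [mul_fn, hd t s h, he t s h]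
  simp only [mul_zero, zero_mul, add_zero, zero_add]
  refine integral_eq_zero_of_ae (ae_of_all _ fun τ => ?_)
  rcases lt_or_ge τ s with h1 | h1
  · simp [he τ s h1]
  · simp [hd t τ (h.trans_le h1)]

theorem mem_and_isCausal_of_mem_analyticTheta (hd : d ∈ analyticTheta) :
    d ∈ boundedMeasurable ∧ d.IsCausal := by
  classical
  obtain ⟨f, hf, rfl⟩ := hd
  have hc : Continuous fun t : unitInterval => f t :=
    continuousOn_iff_continuous_domRestrict.1 hf.continuousOn
  refine ⟨⟨?_, ?_⟩, fun t s h => ?_⟩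
  · exact Measurable.ite (measurableSet_le measurable_snd measurable_fst)
      (hc.measurable.comp measurable_fst) measurable_const
  · obtain ⟨M, hM⟩ := (isCompact_range hc).isBounded.exists_norm_le
    refine ⟨M, fun t s => ?_⟩
    have := hM _ ⟨t, rfl⟩
    simp only [heavisideMul]
    split_ifs
    · exact this
    · rw [norm_zero]
      exact (norm_nonneg _).trans this
  · simp [heavisideMul, h]

theorem mem_and_isCausal_of_mem_D0t (hd : d ∈ D0t) : d ∈ boundedMeasurable ∧ d.IsCausal := by
  obtain ⟨α, n, L, hL, rfl⟩ := hd
  have hp : ∀ l : List StarDist, (∀ g ∈ l, g ∈ analyticTheta) →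
      l.prod ∈ boundedMeasurable ∧ l.prod.IsCausal := by
    intro l hl
    induction l with
    | nil => exact ⟨one_mem_boundedMeasurable, fun _ _ _ => rfl⟩
    | cons g l ih =>
      have hg := mem_and_isCausal_of_mem_analyticTheta (hl g (by simp))
      have hi := ih fun x hx => hl x (by simp [hx])
      rw [List.prod_cons]
      exact ⟨mul_mem_boundedMeasurable hg.1 hi.1, hg.2.mul hi.2⟩
  have hp' := fun i => hp (L i) (hL i).2
  refine ⟨add_mem (smul_mem_boundedMeasurable α one_mem_boundedMeasurable)
    (sum_mem fun i _ => (hp' i).1), fun t s h => ?_⟩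
  rw [add_fn, sum_fn, Finset.sum_eq_zero fun i _ => (hp' i).2 t s h]
  simp

end StarDist

/-! ### Coefficient matrices and `⋆`-products. -/

namespace StarDist

open MeasureTheory

/-- The distribution `(t, s) ↦ p_k(t)`. -/
noncomputable def legendreRow (k : ℕ) : boundedMeasurable :=
  ⟨⟨0, fun t _ => legendreON k t⟩,
    ((legendreC k).continuous.measurable.comp measurable_fst :),
    ‖legendreC k‖, fun t _ => (legendreC k).norm_coe_le_norm t⟩

/-- The distribution `(t, s) ↦ p_k(s)`. -/
noncomputable def legendreCol (k : ℕ) : boundedMeasurable :=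
  ⟨⟨0, fun _ s => legendreON k s⟩,
    ((legendreC k).continuous.measurable.comp measurable_snd :),
    ‖legendreC k‖, fun _ s => (legendreC k).norm_coe_le_norm s⟩

/-- A coefficient becomes a threefold `⋆`-product, so associativity can regroup it. That product is
constant in both variables; the point `(0, 0)` is arbitrary. -/
theorem coeffMatrix_eq (d : boundedMeasurable) (k l : ℕ) :
    coeffMatrix d k l = (legendreCol k * (d * legendreRow l) : boundedMeasurable).1.fn 0 0 := by
  have hp : Integrable fun τ : unitInterval => (legendreON k τ : ℂ) * legendreON l τ :=
    integrable_mul (legendreCol k).2 (legendreRow l).2 0 0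
  have hd := integrable_mul (legendreCol k).2 (d * legendreRow l).2 0 0
  rw [coe_mul, mul_fn]
  simp only [coe_mul, legendreCol, legendreRow, mul_fn, mul_delta, coeffMatrix, Matrix.of_apply,
    pairing, mul_zero, zero_mul, add_zero, zero_add] at hd ⊢
  have e : ∀ τ : unitInterval, (legendreON k τ : ℂ) * (d.1.delta * legendreON l τ +
      ∫ σ : unitInterval, d.1.fn τ σ * legendreON l σ) =
      d.1.delta * ((legendreON k τ : ℂ) * legendreON l τ) + 0 * 0 +
        ∫ σ : unitInterval, d.1.fn τ σ * ((legendreON k τ * legendreON l σ : ℝ) : ℂ) := by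
    intro τ
    rw [mul_add, ← integral_const_mul]
    push_cast
    congr 1
    · ring
    · congr 1
      ext σ
      ring
  simp_rw [e] at hd ⊢
  rw [integral_combination (g := fun _ => 0) hp (integrable_zero _ _ _) hd]
  simp

/-- The coefficient matrix of a `⋆`-product is the product of the coefficient matrices. -/
theorem hasSum_coeffMatrix_mul (d e : boundedMeasurable) (k l : ℕ) :
    HasSum (fun r => coeffMatrix d k r * coeffMatrix e r l)
      (coeffMatrix (d * e : boundedMeasurable) k l) := by
  have hmem : ∀ {f : unitInterval → ℂ}, Measurable f → (∃ M, ∀ t, ‖f t‖ ≤ M) →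
      MemLp f 2 volume := fun hf ⟨M, hM⟩ =>
    MemLp.of_bound hf.aestronglyMeasurable M (ae_of_all _ hM)
  have hu := (legendreCol k * d).2
  have hv := (e * legendreRow l).2
  have h := hasSum_integral_legendreON
    (hmem (measurable_right hu 0) (hu.2.imp fun M hM => hM 0))
    (hmem (measurable_left hv 0) (hv.2.imp fun M hM t => hM t 0))
  convert! h using 1
  · ext r
    congr 1
    · rw [coeffMatrix_eq, ← mul_assoc, coe_mul, mul_fn]
      simp [coe_mul, legendreCol, legendreRow]
    · rw [coeffMatrix_eq, coe_mul, mul_fn]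
      simp [coe_mul, legendreCol, legendreRow]
  · rw [coeffMatrix_eq, mul_assoc, ← mul_assoc, coe_mul, mul_fn]
    simp [coe_mul, legendreCol, legendreRow]

theorem coeffMatrix_add (d e : boundedMeasurable) (k l : ℕ) :
    coeffMatrix (d + e : boundedMeasurable) k l = coeffMatrix d k l + coeffMatrix e k l := by
  simp only [coeffMatrix_eq, add_mul, mul_add]
  rfl

theorem blockCoeff_apply {N : ℕ} (A : Matrix (Fin N) (Fin N) StarDist) (p q : Fin N × ℕ) :
    blockCoeff A p q = coeffMatrix (A p.1 q.1) p.2 q.2 := rfl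

/-- The sum over `Fin N × ℕ` splits into `N` fibres, one for each term of the matrix `⋆`-product;
each fibre is extended by zero. -/
theorem isInfiniteProduct_blockCoeff {N : ℕ} (X Y : Matrix (Fin N) (Fin N) boundedMeasurable) :
    IsInfiniteProduct (blockCoeff (X.map (↑))) (blockCoeff (Y.map (↑)))
      (blockCoeff ((X * Y).map (↑))) := by
  intro p q
  have hsum : ∀ (S : Finset (Fin N)) (f : Fin N → boundedMeasurable) (k l : ℕ),
      coeffMatrix (∑ j ∈ S, f j : boundedMeasurable) k l = ∑ j ∈ S, coeffMatrix (f j) k l :=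
    fun S f k l => map_sum (⟨⟨fun d => coeffMatrix d k l, by simp [coeffMatrix, pairing]⟩,
      fun d e => coeffMatrix_add d e k l⟩ : boundedMeasurable →+ ℂ) f S
  simp only [blockCoeff_apply, Matrix.map_apply, Matrix.mul_apply]
  rw [hsum]
  have h : ∀ j : Fin N, HasSum (fun r : Fin N × ℕ => if r.1 = j then
      coeffMatrix (X p.1 r.1) p.2 r.2 * coeffMatrix (Y r.1 q.1) r.2 q.2 else 0)
      (coeffMatrix (X p.1 j * Y j q.1 : boundedMeasurable) p.2 q.2) := by
    intro j
    rw [← Function.Injective.hasSum_iff (Prod.mk_right_injective j)]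
    · simpa [Function.comp_def] using hasSum_coeffMatrix_mul (X p.1 j) (Y j q.1) p.2 q.2
    · rintro ⟨i, r⟩ hr
      rw [if_neg]
      rintro rfl
      exact hr ⟨r, rfl⟩
  simpa using hasSum_sum fun j (_ : j ∈ Finset.univ) => h j

/-- Infinite matrices have no associative product to calculate in, so `1(1 - Y) + X1 - XY` is summed
entrywise; the first two series have at most one nonzero term. -/
theorem isInfiniteProduct_one_add_mul_one_sub {ι : Type*} [DecidableEq ι] {X Y W : Matrix ι ι ℂ}
    (h : IsInfiniteProduct X Y W) (hW : W + Y = X) : IsInfiniteProduct (1 + X) (1 - Y) 1 := by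
  intro p q
  have h1 : HasSum (fun r => (1 : Matrix ι ι ℂ) p r * (1 - Y) r q) ((1 - Y) p q) := by
    convert hasSum_single (f := fun r => (1 : Matrix ι ι ℂ) p r * (1 - Y) r q) p ?_ using 1
    · simp
    · intro r hr
      simp [Matrix.one_apply_ne hr.symm]
  have h2 : HasSum (fun r => X p r * (1 : Matrix ι ι ℂ) r q) (X p q) := by
    convert hasSum_single (f := fun r => X p r * (1 : Matrix ι ι ℂ) r q) q ?_ using 1
    · simp
    · intro r hr
      simp [Matrix.one_apply_ne hr]
  convert! (h1.add h2).sub (h p q) using 1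
  · ext r
    simp only [Matrix.add_apply, Matrix.sub_apply]
    ring
  · simp [← hW]

theorem isInfiniteProduct_one_sub_mul_one_add {ι : Type*} [DecidableEq ι] {X Y W : Matrix ι ι ℂ}
    (h : IsInfiniteProduct X Y W) (hW : W + X = Y) : IsInfiniteProduct (1 - X) (1 + Y) 1 := by
  have h' : IsInfiniteProduct (-X) (-Y) W := fun p q => by simpa using h p q
  simpa [sub_eq_add_neg] using
    isInfiniteProduct_one_add_mul_one_sub h' (show W + -Y = -X by rw [← hW]; abel)

/-! ### The `⋆`-powers and convergence of their series. -/

theorem starPow_map {N : ℕ} (A : Matrix (Fin N) (Fin N) boundedMeasurable) (k : ℕ) :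
    starPow (A.map (↑)) k = (A ^ (k + 1)).map (↑) := by
  induction k with
  | zero => simp [starPow]
  | succ k ih =>
    ext1 i j
    rw [starPow, ih, pow_succ A (k + 1)]
    simp only [Matrix.mul_apply, Matrix.map_apply, AddSubmonoid.coe_finsetSum, coe_mul]

theorem integral_one_sub_pow (k : ℕ) (s : unitInterval) :
    ∫ τ : unitInterval, (if s ≤ τ then (1 - (τ : ℝ)) ^ k else 0) =
      (1 - (s : ℝ)) ^ (k + 1) / (k + 1) := by
  have h := integral_unitInterval_eq fun x => if (s : ℝ) ≤ x then (1 - x) ^ k else 0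
  have e : ∫ x in (0 : ℝ)..1, (if (s : ℝ) ≤ x then (1 - x) ^ k else 0) =
      ∫ x in (s : ℝ)..1, (1 - x) ^ k := by
    rw [intervalIntegral.integral_of_le zero_le_one, intervalIntegral.integral_of_le s.2.2,
      ← integral_Icc_eq_integral_Ioc, ← integral_Icc_eq_integral_Ioc,
      ← integral_indicator measurableSet_Icc, ← integral_indicator measurableSet_Icc]
    congr 1
    ext x
    have := s.2.1
    by_cases hx : (s : ℝ) ≤ x
    · simp [Set.indicator, hx, this.trans hx]
    · simp [Set.indicator, hx]
  refine h.trans (e.trans ?_)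
  rw [intervalIntegral.integral_comp_sub_left (fun t : ℝ => t ^ k) 1]
  simp

/-- The function parts of the `⋆`-powers of `A` decay factorially if those of `A` are causal. -/
theorem norm_starPow_le {N : ℕ} {A : Matrix (Fin N) (Fin N) StarDist} {M : ℝ}
    (hd : ∀ i j, (A i j).delta = 0) (hc : ∀ i j, (A i j).IsCausal)
    (hM : ∀ i j t s, ‖(A i j).fn t s‖ ≤ M) (k : ℕ) (i j : Fin N) :
    (starPow A k i j).delta = 0 ∧ ∀ t s, ‖(starPow A k i j).fn t s‖ ≤
      M * (N * M) ^ k * ((1 - (s : ℝ)) ^ k / k.factorial) := by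
  induction k generalizing i j with
  | zero => simpa [starPow, hd] using hM i j
  | succ k ih =>
    have hM0 : 0 ≤ M := (norm_nonneg _).trans (hM i j 0 0)
    rw [starPow]
    refine ⟨by simp [Matrix.mul_apply, sum_delta, hd], fun t s => ?_⟩
    have hterm : ∀ m, ‖(starPow A k i m * A m j).fn t s‖ ≤
        M * (N * M) ^ k * M * ((1 - (s : ℝ)) ^ (k + 1) / (k + 1).factorial) := by
      intro m
      rw [mul_fn, (ih i m).1, hd, zero_mul, mul_zero, zero_add, zero_add]
      have hfac : ((k + 1).factorial : ℝ) = (k + 1) * k.factorial := by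
        rw [Nat.factorial_succ]
        push_cast
        ring
      -- The target bound is written as an integral over `τ ≥ s`, so that it suffices to compare
      -- integrands.
      have hint : ∫ τ : unitInterval, (M * (N * M) ^ k * M / k.factorial) *
          (if s ≤ τ then (1 - (τ : ℝ)) ^ k else 0) =
          M * (N * M) ^ k * M * ((1 - (s : ℝ)) ^ (k + 1) / (k + 1).factorial) := by
        rw [integral_const_mul, integral_one_sub_pow, hfac]
        field_simp
      rw [← hint]
      refine norm_integral_le_of_norm_le (Integrable.const_mul ?_ _) (ae_of_all _ fun τ => ?_)
      · refine Integrable.of_bound (C := 1) (Measurable.aestronglyMeasurable ?_)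
          (ae_of_all _ fun τ => ?_)
        · exact Measurable.ite measurableSet_Ici (by fun_prop) measurable_const
        · have h0 : 0 ≤ 1 - (τ : ℝ) := sub_nonneg.2 τ.2.2
          have h1 : 1 - (τ : ℝ) ≤ 1 := sub_le_self _ τ.2.1
          split_ifs
          · rw [norm_pow, Real.norm_of_nonneg h0]
            exact pow_le_one₀ h0 h1
          · simp
      · rw [norm_mul]
        split_ifs with h
        · calc _ ≤ M * (N * M) ^ k * ((1 - (τ : ℝ)) ^ k / k.factorial) * M :=
                mul_le_mul ((ih i m).2 t τ) (hM m j τ s) (norm_nonneg _)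
                  ((norm_nonneg _).trans ((ih i m).2 t τ))
            _ = _ := by ring
        · simp [hc m j τ s (not_le.1 h)]
    rw [Matrix.mul_apply, sum_fn]
    refine (norm_sum_le _ _).trans ((Finset.sum_le_sum fun m _ => hterm m).trans_eq ?_)
    rw [Finset.sum_const, Finset.card_univ, Fintype.card_fin, nsmul_eq_mul]
    ring

/-- The Weierstrass test with majorant `M (N M)^k / k!`, where `M` is the sum of bounds for all the
entries. -/
theorem exists_isStarSeriesSum {N : ℕ} {A : Matrix (Fin N) (Fin N) StarDist}
    (hA : ∀ i j, A i j ∈ boundedMeasurable) (hc : ∀ i j, (A i j).IsCausal)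
    (hd : ∀ i j, (A i j).delta = 0) : ∃ C, IsStarSeriesSum A C := by
  choose K hK0 hK using fun i j => exists_pos_bound (hA i j)
  have hM : ∀ i j t s, ‖(A i j).fn t s‖ ≤ ∑ i, ∑ j, K i j := fun i j t s =>
    (hK i j t s).trans <|
      (Finset.single_le_sum (f := fun j => K i j) (fun j _ => (hK0 i j).le)
        (Finset.mem_univ j)).trans <|
      Finset.single_le_sum (f := fun i => ∑ j, K i j)
        (fun i _ => Finset.sum_nonneg fun j _ => (hK0 i j).le) (Finset.mem_univ i)
  set M := ∑ i, ∑ j, K i j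
  have hb := norm_starPow_le hd hc hM
  refine ⟨Matrix.of fun i j => ⟨0, fun t s => ∑' k, (starPow A k i j).fn t s⟩, fun i j => ⟨?_, ?_⟩⟩
  · simp [sum_delta, (hb _ i j).1]
  · have hM0 : 0 ≤ M := (norm_nonneg _).trans (hM i j 0 0)
    have hs : Summable fun k : ℕ => M * ((N * M) ^ k / k.factorial) :=
      (Real.summable_pow_div_factorial (N * M)).mul_left M
    simp only [sum_fn]
    refine tendstoUniformly_tsum_nat (f := fun k (x : unitInterval × unitInterval) =>
      (starPow A k i j).fn x.1 x.2) hs fun k x => ((hb k i j).2 x.1 x.2).trans ?_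
    have h0 : 0 ≤ 1 - (x.2 : ℝ) := sub_nonneg.2 x.2.2.2
    have h1 : (1 - (x.2 : ℝ)) ^ k ≤ 1 := pow_le_one₀ h0 (sub_le_self _ x.2.2.1)
    calc _ ≤ M * (N * M) ^ k * (1 / k.factorial) := by gcongr
      _ = _ := by ring

/-! ### Uniform limits and `⋆`. -/

variable {D : ℕ → StarDist} {d e : StarDist}

theorem mem_boundedMeasurable_of_tendstoUniformly (hD : ∀ n, D n ∈ boundedMeasurable)
    (h : TendstoUniformly (fun n (x : unitInterval × unitInterval) => (D n).fn x.1 x.2)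
      (fun x => d.fn x.1 x.2) atTop) : d ∈ boundedMeasurable := by
  refine ⟨measurable_of_tendsto_metrizable (fun n => (hD n).1)
    (tendsto_pi_nhds.2 fun x => h.tendsto_at x), ?_⟩
  obtain ⟨n, hn⟩ := (Metric.tendstoUniformly_iff.1 h 1 one_pos).exists
  obtain ⟨M, -, hM⟩ := exists_pos_bound (hD n)
  refine ⟨1 + M, fun t s => ?_⟩
  have h1 := hn (t, s)
  rw [dist_eq_norm] at h1
  calc ‖d.fn t s‖ = ‖(d.fn t s - (D n).fn t s) + (D n).fn t s‖ := by rw [sub_add_cancel]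
    _ ≤ 1 + M := norm_add_le_of_le h1.le (hM t s)

theorem eventually_norm_le_of_tendstoUniformly {M : ℝ} (hM : ∀ t s, ‖d.fn t s‖ ≤ M)
    (h : TendstoUniformly (fun n (x : unitInterval × unitInterval) => (D n).fn x.1 x.2)
      (fun x => d.fn x.1 x.2) atTop) : ∀ᶠ n in atTop, ∀ t s, ‖(D n).fn t s‖ ≤ 1 + M := by
  filter_upwards [Metric.tendstoUniformly_iff.1 h 1 one_pos] with n hn t s
  have h1 := hn (t, s)
  rw [dist_comm, dist_eq_norm] at h1
  calc ‖(D n).fn t s‖ = ‖((D n).fn t s - d.fn t s) + d.fn t s‖ := by rw [sub_add_cancel]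
    _ ≤ 1 + M := norm_add_le_of_le h1.le (hM t s)

/-- Dominated convergence: uniform convergence eventually bounds the function parts by `1 + M`. -/
theorem tendsto_mul_fn_left (hD : ∀ n, D n ∈ boundedMeasurable) (hd : d ∈ boundedMeasurable)
    (he : e ∈ boundedMeasurable) (hδ : Tendsto (fun n => (D n).delta) atTop (𝓝 d.delta))
    (h : TendstoUniformly (fun n (x : unitInterval × unitInterval) => (D n).fn x.1 x.2)
      (fun x => d.fn x.1 x.2) atTop) (t s : unitInterval) :
    Tendsto (fun n => (D n * e).fn t s) atTop (𝓝 ((d * e).fn t s)) := by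
  obtain ⟨M, hM0, hM⟩ := exists_pos_bound hd
  obtain ⟨K, hK0, hK⟩ := exists_pos_bound he
  have hp : ∀ t s, Tendsto (fun n => (D n).fn t s) atTop (𝓝 (d.fn t s)) :=
    fun t s => h.tendsto_at (t, s)
  simp only [mul_fn]
  refine ((hδ.mul_const _).add ((hp t s).mul_const _)).add ?_
  refine tendsto_integral_filter_of_dominated_convergence (fun _ => (1 + M) * K)
    (Eventually.of_forall fun n => (integrable_mul (hD n) he t s).aestronglyMeasurable) ?_
    (integrable_const _) (ae_of_all _ fun τ => (hp t τ).mul_const _)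
  filter_upwards [eventually_norm_le_of_tendstoUniformly hM h] with n hn
  refine ae_of_all _ fun τ => ?_
  rw [norm_mul]
  exact mul_le_mul (hn _ _) (hK _ _) (norm_nonneg _) (by positivity)

theorem tendsto_mul_fn_right (hD : ∀ n, D n ∈ boundedMeasurable) (hd : d ∈ boundedMeasurable)
    (he : e ∈ boundedMeasurable) (hδ : Tendsto (fun n => (D n).delta) atTop (𝓝 d.delta))
    (h : TendstoUniformly (fun n (x : unitInterval × unitInterval) => (D n).fn x.1 x.2)
      (fun x => d.fn x.1 x.2) atTop) (t s : unitInterval) :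
    Tendsto (fun n => (e * D n).fn t s) atTop (𝓝 ((e * d).fn t s)) := by
  obtain ⟨M, hM0, hM⟩ := exists_pos_bound hd
  obtain ⟨K, hK0, hK⟩ := exists_pos_bound he
  have hp : ∀ t s, Tendsto (fun n => (D n).fn t s) atTop (𝓝 (d.fn t s)) :=
    fun t s => h.tendsto_at (t, s)
  simp only [mul_fn]
  refine (((hp t s).const_mul _).add (hδ.const_mul _)).add ?_
  refine tendsto_integral_filter_of_dominated_convergence (fun _ => K * (1 + M))
    (Eventually.of_forall fun n => (integrable_mul he (hD n) t s).aestronglyMeasurable) ?_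
    (integrable_const _) (ae_of_all _ fun τ => (hp τ s).const_mul _)
  filter_upwards [eventually_norm_le_of_tendstoUniformly hM h] with n hn
  refine ae_of_all _ fun τ => ?_
  rw [norm_mul]
  exact mul_le_mul (hK _ _) (hn _ _) (norm_nonneg _) hK0.le

/-! ### The resolvent identities. -/

section Resolvent

variable {N : ℕ} {A : Matrix (Fin N) (Fin N) boundedMeasurable}

theorem sum_starPow_map (n : ℕ) (i j : Fin N) :
    ∑ k ∈ Finset.range n, starPow (A.map (↑)) k i j =
      ((∑ k ∈ Finset.range n, A ^ (k + 1)) i j : boundedMeasurable) := by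
  simp only [starPow_map, Matrix.map_apply, Matrix.sum_apply, AddSubmonoid.coe_finsetSum]

theorem sum_pow_mul_add (n : ℕ) : (∑ k ∈ Finset.range n, A ^ (k + 1)) * A + A =
    ∑ k ∈ Finset.range (n + 1), A ^ (k + 1) := by
  rw [Finset.sum_range_succ', Finset.sum_mul]
  simp [pow_succ]

theorem mul_sum_pow_add (n : ℕ) : A * (∑ k ∈ Finset.range n, A ^ (k + 1)) + A =
    ∑ k ∈ Finset.range (n + 1), A ^ (k + 1) := by
  rw [Finset.sum_range_succ', Finset.mul_sum]
  simp [← pow_succ']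

/-- Both sides are limits of the same sequence, by `sum_pow_mul_add`; the index shift accounts for
`tendsto_add_atTop_nat 1`. -/
theorem IsStarSeriesSum.mul_add {C : Matrix (Fin N) (Fin N) boundedMeasurable}
    (h : IsStarSeriesSum (A.map (↑)) (C.map (↑))) : C * A + A = C := by
  simp only [IsStarSeriesSum, sum_starPow_map, Matrix.map_apply] at h
  ext1 i j
  refine Subtype.ext (StarDist.ext ?_ (funext fun t => funext fun s => ?_))
  · refine tendsto_nhds_unique ?_ ((h i j).1.comp (tendsto_add_atTop_nat 1))
    simp only [Function.comp_def, ← sum_pow_mul_add, Matrix.add_apply, Matrix.mul_apply,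
      AddSubmonoid.coe_add, AddSubmonoid.coe_finsetSum, coe_mul, add_delta, sum_delta, mul_delta]
    exact (tendsto_finsetSum _ fun m _ => (h i m).1.mul_const _).add_const _
  · refine tendsto_nhds_unique ?_ (((h i j).2.tendsto_at (t, s)).comp (tendsto_add_atTop_nat 1))
    simp only [Function.comp_def, ← sum_pow_mul_add, Matrix.add_apply, Matrix.mul_apply,
      AddSubmonoid.coe_add, AddSubmonoid.coe_finsetSum, coe_mul, add_fn, sum_fn]
    exact (tendsto_finsetSum _ fun m _ => tendsto_mul_fn_left (fun n => Subtype.prop _)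
      (C i m).2 (A m j).2 (h i m).1 (h i m).2 t s).add_const _

theorem IsStarSeriesSum.add_mul {C : Matrix (Fin N) (Fin N) boundedMeasurable}
    (h : IsStarSeriesSum (A.map (↑)) (C.map (↑))) : A * C + A = C := by
  simp only [IsStarSeriesSum, sum_starPow_map, Matrix.map_apply] at h
  ext1 i j
  refine Subtype.ext (StarDist.ext ?_ (funext fun t => funext fun s => ?_))
  · refine tendsto_nhds_unique ?_ ((h i j).1.comp (tendsto_add_atTop_nat 1))
    simp only [Function.comp_def, ← mul_sum_pow_add, Matrix.add_apply, Matrix.mul_apply,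
      AddSubmonoid.coe_add, AddSubmonoid.coe_finsetSum, coe_mul, add_delta, sum_delta, mul_delta]
    exact (tendsto_finsetSum _ fun m _ => (h m j).1.const_mul _).add_const _
  · refine tendsto_nhds_unique ?_ (((h i j).2.tendsto_at (t, s)).comp (tendsto_add_atTop_nat 1))
    simp only [Function.comp_def, ← mul_sum_pow_add, Matrix.add_apply, Matrix.mul_apply,
      AddSubmonoid.coe_add, AddSubmonoid.coe_finsetSum, coe_mul, add_fn, sum_fn]
    exact (tendsto_finsetSum _ fun m _ => tendsto_mul_fn_right (fun n => Subtype.prop _)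
      (C m j).2 (A i m).2 (h m j).1 (h m j).2 t s).add_const _

theorem blockCoeff_add (X Y : Matrix (Fin N) (Fin N) boundedMeasurable) :
    blockCoeff ((X + Y).map (↑)) = blockCoeff (X.map (↑)) + blockCoeff (Y.map (↑)) := by
  ext p q
  exact coeffMatrix_add _ _ _ _

end Resolvent

end StarDist

open StarDist in
theorem mainTheorem1 (N : ℕ) (A : Matrix (Fin N) (Fin N) StarDist)
    (hA : ∀ i j, A i j ∈ D0t) :
    ((∀ i j, (A i j).delta = 0) → ∃ C, IsStarSeriesSum A C) ∧
    ∀ C : Matrix (Fin N) (Fin N) StarDist, IsStarSeriesSum A C →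
      IsInfiniteProduct (1 + blockCoeff C) (1 - blockCoeff A) 1 ∧
      IsInfiniteProduct (1 - blockCoeff A) (1 + blockCoeff C) 1 := by
  have hA' := fun i j => mem_and_isCausal_of_mem_D0t (hA i j)
  refine ⟨exists_isStarSeriesSum (fun i j => (hA' i j).1) fun i j => (hA' i j).2, fun C hC => ?_⟩
  obtain ⟨A, rfl⟩ : ∃ B : Matrix (Fin N) (Fin N) boundedMeasurable, B.map (↑) = A :=
    ⟨Matrix.of fun i j => ⟨A i j, (hA' i j).1⟩, rfl⟩
  -- The sum inherits boundedness and measurability from its partial sums, so the identities can be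
  -- stated in the semiring.
  have hC' : ∀ i j, C i j ∈ boundedMeasurable := fun i j =>
    mem_boundedMeasurable_of_tendstoUniformly
      (fun n => by rw [sum_starPow_map]; exact Subtype.prop _) (hC i j).2
  obtain ⟨C, rfl⟩ : ∃ B : Matrix (Fin N) (Fin N) boundedMeasurable, B.map (↑) = C :=
    ⟨Matrix.of fun i j => ⟨C i j, hC' i j⟩, rfl⟩
  exact ⟨isInfiniteProduct_one_add_mul_one_sub (isInfiniteProduct_blockCoeff C A)
      (by rw [← blockCoeff_add, IsStarSeriesSum.mul_add hC]),
    isInfiniteProduct_one_sub_mul_one_add (isInfiniteProduct_blockCoeff A C)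
      (by rw [← blockCoeff_add, IsStarSeriesSum.add_mul hC])⟩
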